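/- For a group $G$ let $\gamma_1(G)=G$ and $\gamma_{r+1}(G)=[\gamma_r(G),G]$ denote the terms of its lower central series. For integers $n\ge 1$, let $$\Gamma_n=\langle a_1,a_2,\dots,a_n \mid a_1^2a_2^2\cdots a_n^2=1\rangle$$ be the fundamental group of the closed non-orientable surface of genus $n$. For $r\ge 0$ and $c\ge 1$ let $N_{r,c}=F_r/\gamma_{c+1}(F_r)$ be the free nilpotent group of class $c$ on $r$ generators, where $F_r$ is the free group on $x_1,\dots,x_r$. Theorem. Let $g\ge 0$ and $c\ge 1$ be integers, and let $e_1,\dots,e_g$ be the images of the first $g$ generators $a_1,\dots,a_g$ of $\Gamma_{g+1}$ in the $c$-step nilpotent quotient $\Gamma_{g+1}/\gamma_{c+1}(\Gamma_{g+1})$. Then the subgroup $\langle e_1,\dots,e_g\rangle$ of $\Gamma_{g+1}/\gamma_{c+1}(\Gamma_{g+1})$ is a free nilpotent group of class $c$ freely generated by $e_1,\dots,e_g$; that is, there is a group isomorphism $N_{g,c}\to\langle e_1,\dots,e_g\rangle$ that maps the image of $x_i$ in $N_{g,c}$ to $e_i$ for every $i=1,\dots,g$. Moreover, this subgroup has finite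 index in $\Gamma_{g+1}/\gamma_{c+1}(\Gamma_{g+1})$. -/

import Mathlib

/-- The `c`-step nilpotent quotient `G / γ_{c+1}(G)`, where `γ_1(G) = G` and
`γ_{r+1}(G) = [γ_r(G), G]`. Mathlib numbers the lower central series from `0`, so that
`γ_{c+1}(G)` is its term number `c`. -/
abbrev NilpotentQuotient (G : Type*) [Group G] (c : ℕ) : Type _ :=
  G ⧸ (⊤ : Subgroup G).lowerCentralSeries c

/-- The natural projection `G → G / γ_{c+1}(G)`. -/
abbrev NilpotentQuotient.proj (G : Type*) [Group G] (c : ℕ) : G →* NilpotentQuotient G c :=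
  QuotientGroup.mk' ((⊤ : Subgroup G).lowerCentralSeries c)

/-- The free nilpotent group of class `c` on `r` generators, `N_{r,c} = F_r / γ_{c+1}(F_r)`. -/
abbrev FreeNilpotentGroup (r c : ℕ) : Type :=
  NilpotentQuotient (FreeGroup (Fin r)) c

/-- The standard free generators of `N_{r,c}`. -/
def FreeNilpotentGroup.gen (r c : ℕ) (i : Fin r) : FreeNilpotentGroup r c :=
  NilpotentQuotient.proj (FreeGroup (Fin r)) c (FreeGroup.of i)

/-- The word `a_1² a_2² ⋯ a_n²` (product in this order) in the free group on `a_1, …, a_n`. -/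
def nonorientableRelator (n : ℕ) : FreeGroup (Fin n) :=
  (List.ofFn fun i : Fin n => FreeGroup.of i ^ 2).prod

/-- The fundamental group of the closed non-orientable surface of genus `n`,
`Γ_n = ⟨a_1, …, a_n ∣ a_1² a_2² ⋯ a_n² = 1⟩`. -/
abbrev NonorientableSurfaceGroup (n : ℕ) : Type :=
  PresentedGroup {nonorientableRelator n}

/-- The elements `e_1, …, e_g` of `Γ_{g+1} / γ_{c+1}(Γ_{g+1})`: the natural projections of the
first `g` of the `g + 1` generators `a_1, …, a_{g+1}` of `Γ_{g+1}`. -/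
def surfaceGen (g c : ℕ) (i : Fin g) : NilpotentQuotient (NonorientableSurfaceGroup (g + 1)) c :=
  NilpotentQuotient.proj (NonorientableSurfaceGroup (g + 1)) c (PresentedGroup.of i.castSucc)

/-!
Write `F` for the free group of rank `g`, `Γ` for the surface group of genus `g + 1`, and
`γ_n` for the lower central series. The relation of `Γ` says that the square of the last generator is
the inverse of `w = a_1² ⋯ a_g²`, so a homomorphism from `F` extends to `Γ` as soon as the inverse of
the image of `w` has a square root.

*Injectivity* of `F / γ_{c+1}(F) → Γ / γ_{c+1}(Γ)`. Unitriangular rational matrices have unitriangular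
square roots (`exists_unitriangular_sq_eq`), and those of size `n + 1` form a group that is nilpotent
of class at most `n`. So it suffices that every element of `γ_n(F)` outside `γ_{n+1}(F)` is
detected by a unitriangular representation of size `n + 1` of `F`
(`exists_unitriangular_hom_ne_one`): extended to `Γ`, this representation kills `γ_{n+1}(Γ)`.

The representations are those sending a free generator `a` to `1 + X`, where `X` marks
the occurrences of `a` in a fixed word `l` of length `n` on the first superdiagonal. On `γ_n(F)` their
corner entry is the coefficient of `l` in the lowest term of the Magnus expansion. Two facts about
Lyndon words finish the argument. By the Jacobi identity modulo `γ_{n+1}`, the commutators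
obtained from the Lyndon words of length `n` and their standard bracketing generate `γ_n` modulo
`γ_{n+1}` (`gam_eq_lyndonSpan`). And the Lie polynomial of a Lyndon word is that word plus a
combination of larger words (`FreeMagma.IsLyndon.coeff_eq_zero`, `FreeMagma.IsLyndon.coeff_word`).
So if all coefficients of an element of `γ_n(F)` vanish, then so do the exponents of the Lyndon
commutators in it, one after another in the order of increasing words.

*Finite index.* The subgroup contains a positive power of every generator of the quotient, and in a
finitely generated nilpotent group this forces finite index (`finiteIndex_of_pow_mem`).
-/

open scoped commutatorElement

/-! ### Bracketed Lyndon words -/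

namespace FreeMagma

variable {α : Type*}

/-- The sequence of leaves of a binary tree, read from left to right. -/
def word : FreeMagma α → List α
  | .of a => [a]
  | s * t => s.word ++ t.word

@[simp] theorem word_of (a : α) : (FreeMagma.of a).word = [a] := rfl

@[simp] theorem word_mul (s t : FreeMagma α) : (s * t).word = s.word ++ t.word := rfl

theorem word_ne_nil (t : FreeMagma α) : t.word ≠ [] := by
  induction t <;> simp_all

theorem length_word_pos (t : FreeMagma α) : 0 < t.word.length :=
  List.length_pos_iff.2 t.word_ne_nil

/-- Only finitely many trees over a finite alphabet have a given number of leaves. -/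
theorem finite_setOf_length_word_eq [Finite α] (n : ℕ) :
    {t : FreeMagma α | t.word.length = n}.Finite := by
  induction n using Nat.strong_induction_on with
  | _ n ih =>
    refine ((Set.finite_range (FreeMagma.of : α → FreeMagma α)).union
      (Set.Finite.biUnion (Set.finite_Iio n) fun p hp =>
        Set.Finite.biUnion (Set.finite_Iio n) fun q hq =>
          Set.Finite.image2 (· * ·) (ih p hp) (ih q hq))).subset ?_
    intro t ht
    induction t with
    | ih1 a => exact Or.inl ⟨a, rfl⟩
    | ih2 s t =>
      have hs := s.length_word_pos
      have ht' := t.length_word_pos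
      simp only [Set.mem_ofPred_eq, word_mul, List.length_append] at ht
      refine Or.inr (Set.mem_biUnion (x := s.word.length) ?_
        (Set.mem_biUnion (x := t.word.length) ?_ ⟨s, rfl, t, rfl, rfl⟩)) <;>
      simp only [Set.mem_Iio] <;> omega

variable [LinearOrder α]

/-- The bracketings of Lyndon words given by their standard factorization: a product `s * t` is one
when `s` and `t` are, the word of `s` is smaller than that of `t`, and the word of `t` is at most
that of the right factor of `s`, if `s` is not a letter. -/
def IsLyndon : FreeMagma α → Prop
  | .of _ => True
  | s * t => s.IsLyndon ∧ t.IsLyndon ∧ s.word < t.word ∧ ∀ p q, s = p * q → t.word ≤ q.word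

theorem isLyndon_of (a : α) : (FreeMagma.of a).IsLyndon := trivial

theorem isLyndon_mul {s t : FreeMagma α} : (s * t).IsLyndon ↔
    s.IsLyndon ∧ t.IsLyndon ∧ s.word < t.word ∧ ∀ p q, s = p * q → t.word ≤ q.word := Iff.rfl

end FreeMagma

section Lex

variable {α : Type*} [LinearOrder α]

theorem List.isPrefix_or_append_lt_append {u v : List α} (h : u < v) :
    u <+: v ∨ ∀ x y, u ++ x < v ++ y := by
  induction u generalizing v with
  | nil => exact Or.inl (List.nil_prefix)
  | cons a u ih =>
    cases v with
    | nil => exact absurd h (List.not_lt_nil _)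
    | cons b v =>
      rcases List.cons_lt_cons_iff.1 h with h | ⟨rfl, h'⟩
      · exact Or.inr fun x y => List.cons_lt_cons_iff.2 (Or.inl h)
      · rcases ih h' with h | h
        · exact Or.inl (by simpa using h)
        · exact Or.inr fun x y => List.cons_lt_cons_iff.2 (Or.inr ⟨rfl, h x y⟩)

theorem List.append_lt_append_of_length_le {u v : List α} (h : u < v) (hl : v.length ≤ u.length)
    (x y : List α) : u ++ x < v ++ y := by
  rcases List.isPrefix_or_append_lt_append h with h' | h'
  · exact absurd (h'.eq_of_length_le hl) h.ne
  · exact h' x y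

theorem List.lt_append_of_ne_nil (u : List α) {v : List α} (hv : v ≠ []) : u < u ++ v := by
  obtain ⟨a, v, rfl⟩ := List.exists_cons_of_ne_nil hv
  have := List.append_left_lt (l₁ := u) (List.nil_lt_cons a v)
  rwa [List.append_nil] at this

/-- The concatenation of `u < v` is smaller than `v` when `v` is smaller than its proper suffixes. -/
theorem List.append_lt_right {u v : List α} (h : u < v) (hu : u ≠ [])
    (hv : ∀ p s, p ≠ [] → s ≠ [] → v = p ++ s → v < s) : u ++ v < v := by
  rcases List.isPrefix_or_append_lt_append h with ⟨s, rfl⟩ | h'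
  · have hs : s ≠ [] := by rintro rfl; simp at h
    exact List.append_left_lt (hv u s hu hs rfl)
  · simpa using h' v []

end Lex

namespace FreeMagma

variable {α : Type*} [LinearOrder α]

/-- The word of a bracketing in the sense of `IsLyndon` is a Lyndon word: it is smaller than each of
its proper nonempty suffixes. -/
theorem IsLyndon.word_lt_suffix {t : FreeMagma α} (ht : t.IsLyndon) {p s : List α} (hp : p ≠ [])
    (hs : s ≠ []) (h : t.word = p ++ s) : t.word < s := by
  induction t generalizing p s with
  | ih1 a =>
    have := congrArg List.length h
    have := List.length_pos_iff.2 hp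
    have := List.length_pos_iff.2 hs
    simp at *; omega
  | ih2 u v ihu ihv =>
    obtain ⟨hu, hv, huv, -⟩ := isLyndon_mul.1 ht
    have key : u.word ++ v.word < v.word :=
      List.append_lt_right huv u.word_ne_nil fun p s hp hs h => ihv hv hp hs h
    -- A proper suffix of `u v` is a suffix of `v`, or `c v` for a proper suffix `c` of `u`.
    rw [word_mul] at h ⊢
    rcases List.append_eq_append_iff.1 h with ⟨c, rfl, hc⟩ | ⟨c, hc, rfl⟩
    · rcases eq_or_ne c [] with rfl | hc'
      · simpa [hc] using key
      · exact key.trans (ihv hv hc' hs hc)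
    · rcases eq_or_ne c [] with rfl | hc'
      · simpa using key
      · refine List.append_lt_append_of_length_le (ihu hu hp hc' hc) ?_ _ _
        simp [hc]

theorem word_mul_lt_right {s t : FreeMagma α} (ht : t.IsLyndon) (h : s.word < t.word) :
    (s * t).word < t.word :=
  List.append_lt_right h s.word_ne_nil fun _ _ hp hs h => ht.word_lt_suffix hp hs h

/-- The right factor of a bracketed Lyndon word is its smallest proper suffix, which is why the
word determines the bracketing. -/
theorem IsLyndon.right_le_suffix {u v : FreeMagma α} (ht : (u * v).IsLyndon) {p s : List α}
    (hp : p ≠ []) (hs : s ≠ []) (h : u.word ++ v.word = p ++ s) : v.word ≤ s := by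
  induction u generalizing v p s with
  | ih1 a =>
    rcases List.append_eq_append_iff.1 h with ⟨c, rfl, hc⟩ | ⟨c, hc, rfl⟩
    · rcases eq_or_ne c [] with rfl | hc'
      · simp [hc]
      · exact (ht.2.1.word_lt_suffix hc' hs hc).le
    · rcases eq_or_ne c [] with rfl | hc'
      · simp
      · have := congrArg List.length hc
        have := List.length_pos_iff.2 hp
        have := List.length_pos_iff.2 hc'
        simp at *; omega
  | ih2 u₁ u₂ ih _ =>
    rcases List.append_eq_append_iff.1 h with ⟨c, rfl, hc⟩ | ⟨c, hc, rfl⟩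
    · rcases eq_or_ne c [] with rfl | hc'
      · simp [hc]
      · exact (ht.2.1.word_lt_suffix hc' hs hc).le
    · rcases eq_or_ne c [] with rfl | hc'
      · simp
      · exact ((ht.2.2.2 _ _ rfl).trans (ih ht.1 hp hc' hc)).trans
          (List.lt_append_of_ne_nil c v.word_ne_nil).le

theorem IsLyndon.eq_of_word_eq {s t : FreeMagma α} (hs : s.IsLyndon) (ht : t.IsLyndon)
    (h : s.word = t.word) : s = t := by
  induction s generalizing t with
  | ih1 a =>
    cases t with
    | of b => exact congrArg _ (by simpa using h)
    | mul t₁ t₂ =>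
      have := congrArg List.length h
      have := t₁.length_word_pos
      have := t₂.length_word_pos
      simp at *; omega
  | ih2 s₁ s₂ ih₁ ih₂ =>
    cases t with
    | of b =>
      have := congrArg List.length h
      have := s₁.length_word_pos
      have := s₂.length_word_pos
      simp at *; omega
    | mul t₁ t₂ =>
      rw [mul_eq] at *
      rw [word_mul, word_mul] at h
      have h₂ : s₂.word = t₂.word := le_antisymm
        (hs.right_le_suffix t₁.word_ne_nil t₂.word_ne_nil h)
        (ht.right_le_suffix s₁.word_ne_nil s₂.word_ne_nil h.symm)
      rw [ih₂ hs.2.1 ht.2.1 h₂, ih₁ hs.1 ht.1 (List.append_cancel_right (h₂ ▸ h))]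

end FreeMagma

/-! ### Commutators modulo terms of the lower central series -/

section LowerCentral

variable {G : Type*} [Group G]

theorem commutatorElement_mem_comm {S : Subgroup G} {x y : G} : ⁅x, y⁆ ∈ S ↔ ⁅y, x⁆ ∈ S := by
  rw [← commutatorElement_inv, inv_mem_iff]

/-- The elements of a group that commute with a given element modulo a normal subgroup. -/
def centralizerMod (S : Subgroup G) [S.Normal] (y : G) : Subgroup G :=
  (Subgroup.centralizer {(y : G ⧸ S)}).comap (QuotientGroup.mk' S)

theorem mem_centralizerMod {S : Subgroup G} [S.Normal] {x y : G} :
    x ∈ centralizerMod S y ↔ ⁅x, y⁆ ∈ S := by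
  rw [← QuotientGroup.eq_one_iff (N := S), ← QuotientGroup.mk'_apply (N := S), map_commutatorElement,
    commutatorElement_eq_one_iff_mul_comm]
  simp [centralizerMod, Subgroup.mem_centralizer_singleton_iff]

/-- The three subgroups lemma modulo a normal subgroup. -/
theorem commutator_commutator_le_of_rotate {H₁ H₂ H₃ N : Subgroup G} [N.Normal]
    (h₁ : ⁅⁅H₂, H₃⁆, H₁⁆ ≤ N) (h₂ : ⁅⁅H₃, H₁⁆, H₂⁆ ≤ N) : ⁅⁅H₁, H₂⁆, H₃⁆ ≤ N := by
  rw [← QuotientGroup.ker_mk' N, ← Subgroup.map_eq_bot_iff, Subgroup.map_commutator,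
    Subgroup.map_commutator] at *
  exact Subgroup.commutator_commutator_eq_bot_of_rotate h₁ h₂

variable (G) in
/-- The term `γ_n(G)` of the lower central series in the numbering `γ_1(G) = G`, with
`γ_0(G) = G` as well. -/
def gam (n : ℕ) : Subgroup G := (⊤ : Subgroup G).lowerCentralSeries (n - 1)

@[simp] theorem gam_one : gam G 1 = ⊤ := rfl

theorem gam_succ {n : ℕ} (hn : 1 ≤ n) : gam G (n + 1) = ⁅gam G n, ⊤⁆ := by
  obtain ⟨m, rfl⟩ := Nat.exists_eq_add_of_le' hn
  rfl

instance (n : ℕ) : (gam G n).Normal := by unfold gam; infer_instance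

theorem gam_antitone : Antitone (gam G) := fun _ _ h =>
  Subgroup.lowerCentralSeries_antitone _ (Nat.sub_le_sub_right h 1)

theorem commutator_gam_le (a b : ℕ) : ⁅gam G a, gam G b⁆ ≤ gam G (a + b) := by
  rcases Nat.eq_zero_or_pos a with rfl | ha
  · rw [zero_add]
    exact Subgroup.commutator_le_right _ _
  induction b generalizing a with
  | zero => exact Subgroup.commutator_le_left _ _
  | succ b ih =>
    rcases Nat.eq_zero_or_pos b with rfl | hb
    · rw [zero_add, gam_one, gam_succ ha]
    · rw [Subgroup.commutator_comm, gam_succ hb]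
      refine commutator_commutator_le_of_rotate ?_ ?_
      · rw [Subgroup.commutator_comm ⊤, ← gam_succ ha]
        exact (ih _ (by omega)).trans_eq (congrArg _ (by omega))
      · refine (Subgroup.commutator_mono (ih a ha) le_rfl).trans ?_
        rw [← gam_succ (by omega)]
        exact le_rfl

theorem commutatorElement_mem_gam {a b n : ℕ} {x y : G} (hx : x ∈ gam G a) (hy : y ∈ gam G b)
    (h : n ≤ a + b) : ⁅x, y⁆ ∈ gam G n :=
  gam_antitone h (commutator_gam_le a b (Subgroup.commutator_mem_commutator hx hy))

/-- A subgroup between two consecutive terms of the lower central series is normal, because their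
quotient is central. -/
theorem normal_of_gam_le {S : Subgroup G} {n : ℕ} (h₁ : gam G (n + 1) ≤ S) (h₂ : S ≤ gam G n) :
    S.Normal := by
  refine ⟨fun s hs g => ?_⟩
  have : ⁅g, s⁆ ∈ gam G (n + 1) :=
    commutatorElement_mem_gam (a := 1) (Subgroup.mem_top g) (h₂ hs) (by omega)
  simpa [commutatorElement_def] using S.mul_mem (h₁ this) hs

/-- The Jacobi identity for the bracket induced by commutators on the quotients of consecutive
terms of the lower central series. -/
theorem commutatorElement_mem_of_rotate {S : Subgroup G} [S.Normal] {a b c : ℕ} (ha : 1 ≤ a)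
    (hb : 1 ≤ b) (hc : 1 ≤ c) {x y z : G} (hx : x ∈ gam G a) (hy : y ∈ gam G b) (hz : z ∈ gam G c)
    (hS : gam G (a + b + c + 1) ≤ S) (h₁ : ⁅⁅y, z⁆, x⁆ ∈ S) (h₂ : ⁅⁅z, x⁆, y⁆ ∈ S) :
    ⁅⁅x, y⁆, z⁆ ∈ S := by
  -- Conjugating the last entry changes a triple commutator by an element of higher weight.
  have key : ∀ {a' b' c' : ℕ} {x y z : G}, 1 ≤ b' → a' + b' + c' = a + b + c → x ∈ gam G a' →
      y ∈ gam G b' → z ∈ gam G c' → (⁅⁅x, y⁆, y * z * y⁻¹⁆ ∈ S ↔ ⁅⁅x, y⁆, z⁆ ∈ S) := by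
    intro a' b' c' x y z hb' he hx hy hz
    have h : ⁅⁅y, z⁆, ⁅x, y⁆⁆ ∈ S := hS <| commutatorElement_mem_gam
      (commutatorElement_mem_gam hy hz le_rfl) (commutatorElement_mem_gam hx hy le_rfl) (by omega)
    have he : y * z * y⁻¹ = ⁅y, z⁆ * z := by simp [commutatorElement_def]
    rw [commutatorElement_mem_comm, commutatorElement_mem_comm (y := z), ← mem_centralizerMod,
      ← mem_centralizerMod, he, Subgroup.mul_mem_cancel_left _ (mem_centralizerMod.2 h)]
  have hw := commutatorElement_commutatorElement_conj_mul x y z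
  rw [← key hb rfl hx hy hz]
  rw [← key hc (by omega) hy hz hx] at h₁
  rw [← key ha (by omega) hz hx hy] at h₂
  rw [mul_assoc] at hw
  rw [eq_inv_of_mul_eq_one_left hw]
  exact inv_mem (mul_mem h₁ h₂)

end LowerCentral

/-! ### Lyndon commutators generate the lower central quotients -/

section LyndonSpan

variable {α : Type*} {G : Type*} [Group G]

/-- The iterated commutator in the elements `x a` of a group prescribed by a bracketing. -/
def FreeMagma.comm (x : α → G) : FreeMagma α → G
  | .of a => x a
  | s * t => ⁅s.comm x, t.comm x⁆

@[simp] theorem FreeMagma.comm_of (x : α → G) (a : α) : (FreeMagma.of a).comm x = x a := rfl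

@[simp] theorem FreeMagma.comm_mul (x : α → G) (s t : FreeMagma α) :
    (s * t).comm x = ⁅s.comm x, t.comm x⁆ := rfl

theorem FreeMagma.comm_mem_gam (x : α → G) (t : FreeMagma α) :
    t.comm x ∈ gam G t.word.length := by
  induction t with
  | ih1 a => exact Subgroup.mem_top _
  | ih2 s t hs ht => exact commutatorElement_mem_gam hs ht (by simp)

variable [LinearOrder α]

/-- The subgroup generated modulo `γ_{n+1}(G)` by the commutators prescribed by the Lyndon words of
length `n` that lie in `A`. -/
def lyndonSpan (x : α → G) (n : ℕ) (A : Set (List α)) : Subgroup G :=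
  Subgroup.closure (FreeMagma.comm x '' {t | t.IsLyndon ∧ t.word.length = n ∧ t.word ∈ A}) ⊔
    gam G (n + 1)

theorem gam_succ_le_lyndonSpan (x : α → G) (n : ℕ) (A : Set (List α)) :
    gam G (n + 1) ≤ lyndonSpan x n A := le_sup_right

theorem comm_mem_lyndonSpan (x : α → G) {n : ℕ} {A : Set (List α)} {t : FreeMagma α}
    (ht : t.IsLyndon) (hn : t.word.length = n) (hA : t.word ∈ A) :
    t.comm x ∈ lyndonSpan x n A :=
  Subgroup.mem_sup_left (Subgroup.subset_closure ⟨t, ⟨ht, hn, hA⟩, rfl⟩)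

theorem lyndonSpan_le (x : α → G) {n : ℕ} {A : Set (List α)} {K : Subgroup G}
    (h : ∀ t : FreeMagma α, t.IsLyndon → t.word.length = n → t.word ∈ A → t.comm x ∈ K)
    (hK : gam G (n + 1) ≤ K) : lyndonSpan x n A ≤ K := by
  refine sup_le ((Subgroup.closure_le _).2 ?_) hK
  rintro _ ⟨t, ⟨h₁, h₂, h₃⟩, rfl⟩
  exact h t h₁ h₂ h₃

theorem lyndonSpan_mono (x : α → G) (n : ℕ) {A B : Set (List α)} (h : A ⊆ B) :
    lyndonSpan x n A ≤ lyndonSpan x n B :=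
  lyndonSpan_le x (fun _ h₁ h₂ h₃ => comm_mem_lyndonSpan x h₁ h₂ (h h₃))
    (gam_succ_le_lyndonSpan x n B)

theorem lyndonSpan_le_gam (x : α → G) (n : ℕ) (A : Set (List α)) :
    lyndonSpan x n A ≤ gam G n :=
  lyndonSpan_le x (fun t _ h _ => h ▸ t.comm_mem_gam x) (gam_antitone n.le_succ)

instance (x : α → G) (n : ℕ) (A : Set (List α)) : (lyndonSpan x n A).Normal :=
  normal_of_gam_le (gam_succ_le_lyndonSpan x n A) (lyndonSpan_le_gam x n A)

/-- The commutator of two Lyndon commutators is a product of Lyndon commutators whose words are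
smaller than the larger of the two words. If the concatenation is not the standard factorization,
the left word `u = u₁ u₂` satisfies `u₂ < v`, and the Jacobi identity replaces `[[u₁, u₂], v]` by
brackets whose larger word is smaller than `v`. -/
theorem commutatorElement_comm_mem_lyndonSpan [Finite α] (x : α → G) {u v : FreeMagma α}
    (hu : u.IsLyndon) (hv : v.IsLyndon) (huv : u.word < v.word) :
    ⁅u.comm x, v.comm x⁆ ∈
      lyndonSpan x (u.word.length + v.word.length) (Set.Iio v.word) := by
  obtain ⟨n, hn⟩ : ∃ n, u.word.length + v.word.length = n := ⟨_, rfl⟩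
  induction n using Nat.strong_induction_on generalizing u v with
  | _ n ihn =>
  -- There are finitely many words of bounded length, so induction on `v` is possible.
  have : Finite {l : List α // l.length ≤ n} := (List.finite_length_le α n).to_subtype
  obtain ⟨w, hw⟩ : ∃ w : {l : List α // l.length ≤ n}, v.word = w := ⟨⟨v.word, by omega⟩, rfl⟩
  induction w using WellFoundedLT.induction generalizing u v with
  | _ w ihw =>
  rw [hn]
  -- The larger word of a pair decides, so the induction hypothesis on words applies to both orders.
  have sym : ∀ {s t : FreeMagma α}, s.IsLyndon → t.IsLyndon →
      s.word.length + t.word.length = n → s.word < v.word → t.word < v.word →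
      ⁅s.comm x, t.comm x⁆ ∈ lyndonSpan x n (Set.Iio v.word) := by
    intro s t hs ht hst hsv htv
    have aux : ∀ {s t : FreeMagma α}, s.IsLyndon → t.IsLyndon →
        s.word.length + t.word.length = n → s.word < t.word → t.word < v.word →
        ⁅s.comm x, t.comm x⁆ ∈ lyndonSpan x n (Set.Iio v.word) := by
      intro s t hs ht hst h htv
      have := ihw ⟨t.word, by omega⟩ (by rw [hw] at htv; exact htv) hs ht h hst rfl
      rw [hst] at this
      exact lyndonSpan_mono x n (Set.Iio_subset_Iio htv.le) this
    rcases lt_trichotomy s.word t.word with h | h | h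
    · exact aux hs ht hst h htv
    · rw [hs.eq_of_word_eq ht h, commutatorElement_self]
      exact one_mem _
    · rw [commutatorElement_mem_comm]
      exact aux ht hs (by omega) h hsv
  by_cases hstd : ∀ p q, u = p * q → v.word ≤ q.word
  · exact comm_mem_lyndonSpan x (t := u * v) ⟨hu, hv, huv, hstd⟩ (by simpa using hn)
      (FreeMagma.word_mul_lt_right hv huv)
  · push Not at hstd
    obtain ⟨p, q, rfl, hqv⟩ := hstd
    have hp := hu.1
    have hq := hu.2.1
    have hpq := hu.2.2.1
    have hpv : p.word < v.word := hpq.trans hqv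
    have hpl := p.length_word_pos
    have hql := q.length_word_pos
    have hvl := v.length_word_pos
    simp only [FreeMagma.word_mul, List.length_append] at hn
    rw [FreeMagma.comm_mul]
    refine commutatorElement_mem_of_rotate hpl hql hvl (p.comm_mem_gam x) (q.comm_mem_gam x)
      (v.comm_mem_gam x) (hn ▸ gam_succ_le_lyndonSpan x _ _) ?_ ?_
    · have h := ihn _ (by omega) hq hv hqv rfl
      rw [← mem_centralizerMod]
      refine lyndonSpan_le x (fun t ht htl htv => ?_) (fun y hy => ?_) h
      · rw [mem_centralizerMod]
        exact sym ht hp (by omega) htv hpv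
      · rw [mem_centralizerMod]
        exact gam_succ_le_lyndonSpan x _ _
          (commutatorElement_mem_gam hy (p.comm_mem_gam x) (by omega))
    · have h := ihn _ (by omega) hp hv hpv rfl
      rw [← mem_centralizerMod, ← inv_mem_iff, commutatorElement_inv]
      refine lyndonSpan_le x (fun t ht htl htv => ?_) (fun y hy => ?_) h
      · rw [mem_centralizerMod]
        exact sym ht hq (by omega) htv hqv
      · rw [mem_centralizerMod]
        exact gam_succ_le_lyndonSpan x _ _
          (commutatorElement_mem_gam hy (q.comm_mem_gam x) (by omega))

/-- The Lyndon commutators of weight `n` in a generating family generate `γ_n` modulo `γ_{n+1}`. -/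
theorem gam_eq_lyndonSpan [Finite α] {x : α → G} (hx : Subgroup.closure (Set.range x) = ⊤) {n : ℕ}
    (hn : 1 ≤ n) : gam G n = lyndonSpan x n Set.univ := by
  refine le_antisymm ?_ (lyndonSpan_le_gam x n _)
  induction n, hn using Nat.le_induction with
  | base =>
    rw [gam_one, ← hx, Subgroup.closure_le]
    rintro _ ⟨a, rfl⟩
    exact comm_mem_lyndonSpan x (FreeMagma.isLyndon_of a) rfl trivial
  | succ n hn ih =>
    rw [gam_succ hn, Subgroup.commutator_le]
    intro y hy z _
    suffices h : gam G n ≤ centralizerMod (lyndonSpan x (n + 1) Set.univ) z from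
      mem_centralizerMod.1 (h hy)
    refine ih.trans (lyndonSpan_le x (fun t ht htl _ => ?_) fun y hy => ?_)
    · rw [mem_centralizerMod, commutatorElement_mem_comm, ← mem_centralizerMod]
      suffices h : (⊤ : Subgroup G) ≤ _ from h (Subgroup.mem_top z)
      rw [← hx, Subgroup.closure_le]
      rintro _ ⟨a, rfl⟩
      rw [SetLike.mem_coe, mem_centralizerMod]
      have ha := FreeMagma.isLyndon_of a
      have hl : (FreeMagma.of a).word.length = 1 := rfl
      rcases lt_trichotomy (FreeMagma.of a).word t.word with h | h | h
      · have := commutatorElement_comm_mem_lyndonSpan x ha ht h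
        rw [hl, htl, add_comm] at this
        exact lyndonSpan_mono x _ (Set.subset_univ _) this
      · rw [← ha.eq_of_word_eq ht h, FreeMagma.comm_of, commutatorElement_self]
        exact one_mem _
      · have := commutatorElement_comm_mem_lyndonSpan x ht ha h
        rw [hl, htl] at this
        rw [commutatorElement_mem_comm]
        exact lyndonSpan_mono x _ (Set.subset_univ _) this
    · rw [mem_centralizerMod]
      exact gam_succ_le_lyndonSpan x _ _
        (commutatorElement_mem_gam (b := 1) hy (Subgroup.mem_top z) (by omega))

end LyndonSpan

/-! ### Unitriangular matrices -/

section Band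

variable {m : ℕ}

/-- The `m × m` rational matrices that vanish below the `k`-th superdiagonal. -/
def band (m k : ℕ) : Submodule ℚ (Matrix (Fin m) (Fin m) ℚ) where
  carrier := {M | ∀ i j : Fin m, (j : ℕ) < i + k → M i j = 0}
  add_mem' ha hb i j h := by simp [ha i j h, hb i j h]
  zero_mem' _ _ _ := rfl
  smul_mem' c M hM i j h := by simp [hM i j h]

theorem band_antitone : Antitone (band m) := fun _ _ h _ hM i j hij => hM i j (by omega)

theorem mul_mem_band {a b : Matrix (Fin m) (Fin m) ℚ} {p q n : ℕ} (ha : a ∈ band m p)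
    (hb : b ∈ band m q) (h : n ≤ p + q) : a * b ∈ band m n := by
  intro i j hij
  rw [Matrix.mul_apply]
  refine Finset.sum_eq_zero fun l _ => ?_
  rcases lt_or_ge (l : ℕ) (i + p) with hl | hl
  · rw [ha i l hl, zero_mul]
  · rw [hb l j (by omega), mul_zero]

theorem mul_apply_of_mem_band {a b : Matrix (Fin m) (Fin m) ℚ} {p q : ℕ} (ha : a ∈ band m p)
    (hb : b ∈ band m q) {i l j : Fin m} (hl : (l : ℕ) = i + p) (hj : (j : ℕ) = l + q) :
    (a * b) i j = a i l * b l j := by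
  rw [Matrix.mul_apply]
  refine Finset.sum_eq_single l (fun k _ hk => ?_) (by simp)
  rcases lt_or_gt_of_ne (Fin.val_ne_of_ne hk) with h | h
  · rw [ha i k (by omega), zero_mul]
  · rw [hb k j (by omega), mul_zero]

theorem one_mem_band : (1 : Matrix (Fin m) (Fin m) ℚ) ∈ band m 0 := by
  intro i j h
  exact Matrix.one_apply_ne (by rintro rfl; omega)

theorem eq_zero_of_mem_band {a : Matrix (Fin m) (Fin m) ℚ} (ha : a ∈ band m m) : a = 0 := by
  ext i j
  exact ha i j (by omega)

/-- The group of invertible matrices that agree with the identity below the `k`-th superdiagonal,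
together with their inverses. -/
def unitriangular (m k : ℕ) : Subgroup (Matrix (Fin m) (Fin m) ℚ)ˣ where
  carrier := {u | (u : Matrix (Fin m) (Fin m) ℚ) - 1 ∈ band m k ∧
    ((u⁻¹ : (Matrix (Fin m) (Fin m) ℚ)ˣ) : Matrix (Fin m) (Fin m) ℚ) - 1 ∈ band m k}
  one_mem' := by simp
  inv_mem' h := ⟨h.2, by simpa using h.1⟩
  mul_mem' := by
    have key : ∀ {a b : Matrix (Fin m) (Fin m) ℚ}, a - 1 ∈ band m k → b - 1 ∈ band m k →
        a * b - 1 ∈ band m k := by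
      intro a b ha hb
      have : a * b - 1 = (a - 1) * (b - 1) + (a - 1) + (b - 1) := by noncomm_ring
      rw [this]
      exact add_mem (add_mem (mul_mem_band ha hb (by omega)) ha) hb
    intro u v hu hv
    refine ⟨?_, ?_⟩
    · rw [Units.val_mul]
      exact key hu.1 hv.1
    · rw [mul_inv_rev, Units.val_mul]
      exact key hv.2 hu.2

theorem unitriangular_self (m : ℕ) : unitriangular m m = ⊥ := by
  rw [eq_bot_iff]
  intro u hu
  exact Units.ext (sub_eq_zero.1 (eq_zero_of_mem_band hu.1))

theorem mem_band_zero_of_sub_one_mem {a : Matrix (Fin m) (Fin m) ℚ} {k : ℕ}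
    (h : a - 1 ∈ band m k) : a ∈ band m 0 := by
  have := add_mem (band_antitone (Nat.zero_le k) h) one_mem_band
  simpa using this

theorem coe_commutatorElement_sub_one (u v : (Matrix (Fin m) (Fin m) ℚ)ˣ) :
    ((⁅u, v⁆ : (Matrix (Fin m) (Fin m) ℚ)ˣ) : Matrix (Fin m) (Fin m) ℚ) - 1 =
      (((u : Matrix (Fin m) (Fin m) ℚ) - 1) * (v - 1) - (v - 1) * (u - 1)) *
        ((u⁻¹ * v⁻¹ : (Matrix (Fin m) (Fin m) ℚ)ˣ) : Matrix (Fin m) (Fin m) ℚ) := by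
  have h : ((u : Matrix (Fin m) (Fin m) ℚ) - 1) * (v - 1) - (v - 1) * (u - 1) = u * v - v * u := by
    noncomm_ring
  have h' : (v : Matrix (Fin m) (Fin m) ℚ) * u *
      ((u⁻¹ * v⁻¹ : (Matrix (Fin m) (Fin m) ℚ)ˣ) : Matrix (Fin m) (Fin m) ℚ) = 1 := by
    rw [← Units.val_mul, ← Units.val_mul]
    simp
  rw [h, sub_mul, h', ← Units.val_mul, ← Units.val_mul, commutatorElement_def, mul_assoc (u * v)]

theorem commutator_mem_band {a b : Matrix (Fin m) (Fin m) ℚ} {p q : ℕ} (ha : a ∈ band m p)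
    (hb : b ∈ band m q) : a * b - b * a ∈ band m (p + q) :=
  sub_mem (mul_mem_band ha hb le_rfl) (mul_mem_band hb ha (add_comm p q).le)

theorem commutatorElement_mem_unitriangular {u v : (Matrix (Fin m) (Fin m) ℚ)ˣ} {p q : ℕ}
    (hu : u ∈ unitriangular m p) (hv : v ∈ unitriangular m q) :
    ⁅u, v⁆ ∈ unitriangular m (p + q) := by
  have key : ∀ {u v : (Matrix (Fin m) (Fin m) ℚ)ˣ} {p q : ℕ}, u ∈ unitriangular m p →
      v ∈ unitriangular m q → ((⁅u, v⁆ : (Matrix (Fin m) (Fin m) ℚ)ˣ) : Matrix _ _ ℚ) - 1 ∈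
        band m (p + q) := by
    intro u v p q hu hv
    rw [coe_commutatorElement_sub_one, Units.val_mul]
    exact mul_mem_band (commutator_mem_band hu.1 hv.1) (mul_mem_band (n := 0)
      (mem_band_zero_of_sub_one_mem hu.2) (mem_band_zero_of_sub_one_mem hv.2) le_rfl) le_rfl
  refine ⟨key hu hv, ?_⟩
  rw [commutatorElement_inv, add_comm]
  exact key hv hu

/-- To leading order, the group commutator is the commutator of the matrix ring. -/
theorem coe_commutatorElement_apply {u v : (Matrix (Fin m) (Fin m) ℚ)ˣ} {p q : ℕ} (hp : 1 ≤ p)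
    (hq : 1 ≤ q) (hu : u ∈ unitriangular m p) (hv : v ∈ unitriangular m q) {i k l j : Fin m}
    (hk : (k : ℕ) = i + p) (hl : (l : ℕ) = i + q) (hj : (j : ℕ) = i + p + q) :
    (((⁅u, v⁆ : (Matrix (Fin m) (Fin m) ℚ)ˣ) : Matrix (Fin m) (Fin m) ℚ) - 1) i j =
      ((u : Matrix (Fin m) (Fin m) ℚ) - 1) i k * ((v : Matrix (Fin m) (Fin m) ℚ) - 1) k j -
      ((v : Matrix (Fin m) (Fin m) ℚ) - 1) i l * ((u : Matrix (Fin m) (Fin m) ℚ) - 1) l j := by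
  have hw : u⁻¹ * v⁻¹ ∈ unitriangular m 1 :=
    mul_mem (inv_mem ⟨band_antitone hp hu.1, band_antitone hp hu.2⟩)
      (inv_mem ⟨band_antitone hq hv.1, band_antitone hq hv.2⟩)
  have h0 := mul_mem_band (commutator_mem_band hu.1 hv.1) hw.1 le_rfl i j (by omega)
  rw [mul_sub, mul_one, ← coe_commutatorElement_sub_one, Matrix.sub_apply, sub_eq_zero] at h0
  rw [h0, Matrix.sub_apply, mul_apply_of_mem_band hu.1 hv.1 hk (by omega),
    mul_apply_of_mem_band hv.1 hu.1 hl (by omega)]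

/-- The superdiagonal filtration of the unitriangular group bounds the lower central series. -/
theorem gam_le_comap_unitriangular {G : Type*} [Group G] (f : G →* (Matrix (Fin m) (Fin m) ℚ)ˣ)
    (hf : ∀ g, f g ∈ unitriangular m 1) {n : ℕ} (hn : 1 ≤ n) :
    gam G n ≤ (unitriangular m n).comap f := by
  induction n, hn using Nat.le_induction with
  | base => exact fun g _ => hf g
  | succ n hn ih =>
    rw [gam_succ hn, Subgroup.commutator_le]
    intro y hy z _
    rw [Subgroup.mem_comap, map_commutatorElement]
    exact commutatorElement_mem_unitriangular (ih hy) (hf z)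

/-- A matrix that differs from `1` by a strictly upper triangular one is invertible, and its inverse
is of the same form. -/
theorem exists_unitriangular_eq {a : Matrix (Fin m) (Fin m) ℚ} (ha : a - 1 ∈ band m 1) :
    ∃ u ∈ unitriangular m 1, (u : Matrix (Fin m) (Fin m) ℚ) = a := by
  have key : ∀ k, ∃ s : Matrix (Fin m) (Fin m) ℚ, s - 1 ∈ band m 1 ∧ a * s - 1 ∈ band m (k + 1) := by
    intro k
    induction k with
    | zero => exact ⟨1, by simp, by simpa using ha⟩
    | succ k ih =>
      obtain ⟨s, hs, has⟩ := ih
      -- Correcting by the error term moves the error to the next superdiagonal.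
      refine ⟨s - (a * s - 1), ?_, ?_⟩
      · rw [sub_right_comm]
        exact sub_mem hs (band_antitone (by omega) has)
      · have : a * (s - (a * s - 1)) - 1 = -((a - 1) * (a * s - 1)) := by noncomm_ring
        rw [this]
        exact neg_mem (mul_mem_band ha has (by omega))
  obtain ⟨s, hs, has⟩ := key m
  have h := sub_eq_zero.1 (eq_zero_of_mem_band (band_antitone (Nat.le_succ m) has))
  exact ⟨⟨a, s, h, mul_eq_one_comm.1 h⟩, ⟨ha, hs⟩, rfl⟩

/-- Unitriangular rational matrices have unitriangular square roots. -/
theorem exists_unitriangular_sq_eq {w : (Matrix (Fin m) (Fin m) ℚ)ˣ} (hw : w ∈ unitriangular m 1) :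
    ∃ u ∈ unitriangular m 1, u ^ 2 = w := by
  have key : ∀ k, ∃ s : Matrix (Fin m) (Fin m) ℚ, s - 1 ∈ band m 1 ∧
      (w : Matrix (Fin m) (Fin m) ℚ) - s * s ∈ band m (k + 1) := by
    intro k
    induction k with
    | zero => exact ⟨1, by simp, by simpa using hw.1⟩
    | succ k ih =>
      obtain ⟨s, hs, hws⟩ := ih
      -- Correcting by half of the error term moves the error to the next superdiagonal.
      obtain ⟨d, hd⟩ : ∃ d, d = (2⁻¹ : ℚ) • ((w : Matrix (Fin m) (Fin m) ℚ) - s * s) := ⟨_, rfl⟩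
      have hdm : d ∈ band m (k + 1) := hd ▸ (band m (k + 1)).smul_mem _ hws
      have hdd : (w : Matrix (Fin m) (Fin m) ℚ) - s * s = d + d := by
        rw [hd, ← add_smul]; norm_num
      refine ⟨s + d, ?_, ?_⟩
      · rw [add_sub_right_comm]
        exact add_mem hs (band_antitone (by omega) hdm)
      · have : (w : Matrix (Fin m) (Fin m) ℚ) - (s + d) * (s + d) =
            ((w : Matrix (Fin m) (Fin m) ℚ) - s * s - (d + d)) -
              ((s - 1) * d + d * (s - 1) + d * d) := by
          noncomm_ring
        rw [this, hdd, sub_self, zero_sub]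
        exact neg_mem (add_mem (add_mem (mul_mem_band hs hdm (by omega))
          (mul_mem_band hdm hs (by omega))) (mul_mem_band hdm hdm (by omega)))
  obtain ⟨s, hs, hws⟩ := key m
  have h := sub_eq_zero.1 (eq_zero_of_mem_band (band_antitone (Nat.le_succ m) hws))
  obtain ⟨u, hu, rfl⟩ := exists_unitriangular_eq hs
  exact ⟨u, hu, Units.ext (by rw [h, pow_two, Units.val_mul])⟩

end Band

/-! ### The Magnus expansion of Lyndon commutators -/

section Coeff

variable {α : Type*} [LinearOrder α]

/-- The coefficient of a word in the Lie polynomial obtained from a bracketing by reading products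
as commutators in the free associative algebra; it is meant for words of the length of `t`. -/
def FreeMagma.coeff : FreeMagma α → List α → ℚ
  | .of a, l => if l = [a] then 1 else 0
  | s * t, l => s.coeff (l.take s.word.length) * t.coeff (l.drop s.word.length) -
      t.coeff (l.take t.word.length) * s.coeff (l.drop t.word.length)

theorem FreeMagma.coeff_mul (s t : FreeMagma α) (l : List α) :
    (s * t).coeff l = s.coeff (l.take s.word.length) * t.coeff (l.drop s.word.length) -
      t.coeff (l.take t.word.length) * s.coeff (l.drop t.word.length) := rfl

/-- If `l < s ++ t`, then splitting `l` after `s.length` letters gives a first part smaller than `s`,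
or equal to `s` with a second part smaller than `t`. -/
theorem List.take_lt_or_of_lt_append {l s t : List α} (hl : s.length ≤ l.length)
    (h : l < s ++ t) :
    l.take s.length < s ∨ l.take s.length = s ∧ l.drop s.length < t := by
  have hlen : (l.take s.length).length = s.length := by simpa using hl
  rw [← List.take_append_drop s.length l] at h
  rcases lt_trichotomy (l.take s.length) s with h₁ | h₁ | h₁
  · exact Or.inl h₁
  · refine Or.inr ⟨h₁, ?_⟩
    rw [h₁] at h
    rcases lt_trichotomy (l.drop s.length) t with h₂ | h₂ | h₂
    · exact h₂
    · exact absurd h (by rw [h₂]; exact lt_irrefl _)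
    · exact absurd h (List.append_left_lt h₂).asymm
  · exact absurd h (List.append_lt_append_of_length_le h₁ hlen.le _ _).asymm

/-- Of the two terms of the commutator, one only involves words that are at least `s.word ++ t.word`,
and the other words that are at least `t.word ++ s.word`, which is larger. Thus the Lie polynomial of
a Lyndon word only involves words that are at least that word. -/
theorem FreeMagma.IsLyndon.coeff_eq_zero {t : FreeMagma α} (ht : t.IsLyndon) {l : List α}
    (hl : l.length = t.word.length) (h : l < t.word) : t.coeff l = 0 := by
  induction t generalizing l with
  | ih1 a => exact if_neg h.ne
  | ih2 s t ihs iht =>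
    rw [word_mul] at h hl
    rw [List.length_append] at hl
    have key : ∀ {s t : FreeMagma α}, l.length = s.word.length + t.word.length →
        (∀ l : List α, l.length = s.word.length → l < s.word → s.coeff l = 0) →
        (∀ l : List α, l.length = t.word.length → l < t.word → t.coeff l = 0) →
        l < s.word ++ t.word →
        s.coeff (l.take s.word.length) * t.coeff (l.drop s.word.length) = 0 := by
      intro s t hl hs ht h
      rcases List.take_lt_or_of_lt_append (by omega) h with h | ⟨-, h⟩
      · rw [hs _ (by simp; omega) h, zero_mul]
      · rw [ht _ (by simp; omega) h, mul_zero]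
    have h' : l < t.word ++ s.word := h.trans <| (word_mul_lt_right ht.2.1 ht.2.2.1).trans
      (List.lt_append_of_ne_nil _ s.word_ne_nil)
    rw [coeff_mul, key hl (fun l => ihs ht.1) (fun l => iht ht.2.1) h,
      key (by omega) (fun l => iht ht.2.1) (fun l => ihs ht.1) h', sub_zero]

theorem FreeMagma.IsLyndon.coeff_word {t : FreeMagma α} (ht : t.IsLyndon) :
    t.coeff t.word = 1 := by
  induction t with
  | ih1 a => exact if_pos rfl
  | ih2 s t ihs iht =>
    have h : s.word ++ t.word < t.word ++ s.word := (word_mul_lt_right ht.2.1 ht.2.2.1).trans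
      (List.lt_append_of_ne_nil _ s.word_ne_nil)
    have h0 : t.coeff ((s.word ++ t.word).take t.word.length) *
        s.coeff ((s.word ++ t.word).drop t.word.length) = 0 := by
      rcases List.take_lt_or_of_lt_append (by simp) h with h | ⟨-, h⟩
      · rw [ht.2.1.coeff_eq_zero (by simp) h, zero_mul]
      · rw [ht.1.coeff_eq_zero (by simp) h, mul_zero]
    rw [coeff_mul, word_mul, h0, List.take_left, List.drop_left, ihs ht.1, iht ht.2.1, sub_zero,
      mul_one]

end Coeff

section Magnus

variable {α : Type*} [LinearOrder α]

/-- The matrix with entry `1` at the place `(i, i + 1)` for every occurrence of the letter `a` at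
position `i` of the word `l`. The products of these matrices read off coefficients of subwords of
`l`. -/
def letterMatrix (m : ℕ) (l : List α) (a : α) : Matrix (Fin m) (Fin m) ℚ :=
  .of fun i j => if (j : ℕ) = i + 1 ∧ l[(i : ℕ)]? = some a then 1 else 0

theorem letterMatrix_mem_band (m : ℕ) (l : List α) (a : α) : letterMatrix m l a ∈ band m 1 := by
  intro i j h
  exact if_neg (by omega)

/-- Evaluated at `1 + letterMatrix m l a`, a commutator of weight `k` lies in the `k`-th term of the
filtration of the unitriangular group, and its entries on the `k`-th superdiagonal are the
coefficients of the subwords of `l` in its Lie polynomial. -/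
theorem comm_sub_one_apply {m : ℕ} {l : List α} {x : α → (Matrix (Fin m) (Fin m) ℚ)ˣ}
    (hx : ∀ a, x a ∈ unitriangular m 1) (hxl : ∀ a, (x a : Matrix (Fin m) (Fin m) ℚ) - 1 =
      letterMatrix m l a) (t : FreeMagma α) :
    t.comm x ∈ unitriangular m t.word.length ∧
    ∀ i j : Fin m, (j : ℕ) = i + t.word.length →
      (((t.comm x : (Matrix (Fin m) (Fin m) ℚ)ˣ) : Matrix (Fin m) (Fin m) ℚ) - 1) i j =
        t.coeff ((l.drop i).take t.word.length) := by
  induction t with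
  | ih1 a =>
    refine ⟨hx a, fun i j hj => ?_⟩
    rw [FreeMagma.comm_of, hxl]
    have h : l[(i : ℕ)]? = some a ↔ (l.drop i).take 1 = [a] := by
      rw [← List.head?_drop]
      rcases l.drop i with _ | ⟨b, l'⟩ <;> simp
    simp only [FreeMagma.word_of, List.length_singleton] at hj ⊢
    simp [letterMatrix, FreeMagma.coeff, hj, h]
  | ih2 s t hs ht =>
    have hsl := s.length_word_pos
    have htl := t.length_word_pos
    rw [FreeMagma.comm_mul, FreeMagma.word_mul, List.length_append]
    refine ⟨commutatorElement_mem_unitriangular hs.1 ht.1, fun i j hj => ?_⟩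
    have hjm := j.2
    rw [coe_commutatorElement_apply hsl htl hs.1 ht.1 (k := ⟨i + s.word.length, by omega⟩)
      (l := ⟨i + t.word.length, by omega⟩) rfl rfl (by omega), hs.2 _ _ rfl,
      ht.2 _ _ (by simp only; omega), ht.2 _ _ rfl, hs.2 _ _ (by simp only; omega), FreeMagma.coeff_mul]
    simp [List.take_take, List.drop_take]

/-- For every word `l` of length `n` there is a homomorphism from the free group to the unitriangular
matrices of size `n + 1` that induces on `γ_n` the coefficient of `l` in the lowest term of the
Magnus expansion. -/
theorem exists_coeff_hom {n : ℕ} (hn : 1 ≤ n) {l : List α} (hl : l.length = n) :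
    ∃ f : FreeGroup α →* (Matrix (Fin (n + 1)) (Fin (n + 1)) ℚ)ˣ,
      (∀ g, f g ∈ unitriangular (n + 1) 1) ∧
      ∃ χ : gam (FreeGroup α) n →* Multiplicative ℚ,
        (∀ g : gam (FreeGroup α) n, f g = 1 → χ g = 1) ∧
        ∀ (t : FreeMagma α) (g : gam (FreeGroup α) n), t.word.length = n →
          (g : FreeGroup α) = t.comm FreeGroup.of → (χ g).toAdd = t.coeff l := by
  choose x hx hxl using fun a => exists_unitriangular_eq (a := 1 + letterMatrix (n + 1) l a)
    (by simpa using letterMatrix_mem_band (n + 1) l a)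
  have hf : ∀ g, FreeGroup.lift x g ∈ unitriangular (n + 1) 1 := by
    intro g
    have : (FreeGroup.lift x).range ≤ unitriangular (n + 1) 1 := by
      rw [FreeGroup.range_lift_eq_closure, Subgroup.closure_le]
      rintro _ ⟨a, rfl⟩
      exact hx a
    exact this ⟨g, rfl⟩
  have hfn : ∀ g : gam (FreeGroup α) n, FreeGroup.lift x (g : FreeGroup α) ∈
      unitriangular (n + 1) n := fun g => gam_le_comap_unitriangular _ hf hn g.2
  refine ⟨FreeGroup.lift x, hf, MonoidHom.mk' (fun g => Multiplicative.ofAdd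
    (((FreeGroup.lift x (g : FreeGroup α) : Matrix (Fin (n + 1)) (Fin (n + 1)) ℚ) - 1) 0
      (Fin.last n))) ?_, ?_, ?_⟩
  · intro g h
    rw [← ofAdd_add, ← Matrix.add_apply]
    congr 1
    have h0 := mul_mem_band (n := n + 1) (hfn g).1 (hfn h).1 (by omega)
    have hmul : ∀ a b : Matrix (Fin (n + 1)) (Fin (n + 1)) ℚ,
        a * b - 1 = (a - 1) * (b - 1) + (a - 1 + (b - 1)) := fun a b => by noncomm_ring
    rw [Subgroup.coe_mul, map_mul, Units.val_mul, hmul, eq_zero_of_mem_band h0, zero_add]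
  · intro g h
    simp [h]
  · intro t g ht hg
    have hcomm : FreeGroup.lift x (t.comm FreeGroup.of) = t.comm x := by
      clear ht hg
      induction t with
      | ih1 a => simp
      | ih2 s t hs ht => rw [FreeMagma.comm_mul, map_commutatorElement, hs, ht, FreeMagma.comm_mul]
    have := (comm_sub_one_apply hx (fun a => by rw [hxl, add_sub_cancel_left]) t).2 0
      (Fin.last n) (by simp [ht])
    rw [MonoidHom.mk'_apply, toAdd_ofAdd, hg, hcomm, this, ht]
    simp [← hl]

/-- **Witt's theorem**, by way of the Magnus expansion: an element of `γ_n(F)` outside `γ_{n+1}(F)`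
of a free group `F` is detected by a homomorphism to the unitriangular matrices of size `n + 1`. -/
theorem exists_unitriangular_hom_ne_one [Finite α] {n : ℕ} (hn : 1 ≤ n) {u : FreeGroup α}
    (hu : u ∈ gam (FreeGroup α) n) (hu' : u ∉ gam (FreeGroup α) (n + 1)) :
    ∃ f : FreeGroup α →* (Matrix (Fin (n + 1)) (Fin (n + 1)) ℚ)ˣ,
      (∀ g, f g ∈ unitriangular (n + 1) 1) ∧ f u ≠ 1 := by
  by_contra! hcon
  refine hu' ?_
  -- The Lyndon commutators occurring in `u` are removed in the order of increasing words: the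
  -- exponent of the smallest one is the coefficient of its word.
  have key : ∀ T : Finset (FreeMagma α), (∀ t ∈ T, t.IsLyndon ∧ t.word.length = n) →
      u ∈ Subgroup.closure (FreeMagma.comm FreeGroup.of '' (T : Set (FreeMagma α))) ⊔
        gam (FreeGroup α) (n + 1) → u ∈ gam (FreeGroup α) (n + 1) := by
    intro T
    refine Finset.induction_on_min_value FreeMagma.word T ?_ ?_
    · intro _ h
      simpa using h
    · intro t T htT hmin ih hT h
      have htn := hT t (Finset.mem_insert_self t T)
      have hT' : ∀ s ∈ T, s.IsLyndon ∧ s.word.length = n :=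
        fun s hs => hT s (Finset.mem_insert_of_mem hs)
      obtain ⟨N, hN⟩ : ∃ N, N = Subgroup.closure (FreeMagma.comm FreeGroup.of ''
        (T : Set (FreeMagma α))) ⊔ gam (FreeGroup α) (n + 1) := ⟨_, rfl⟩
      have hNle : N ≤ gam (FreeGroup α) n := by
        rw [hN]
        refine sup_le ((Subgroup.closure_le _).2 ?_) (gam_antitone n.le_succ)
        rintro _ ⟨s, hs, rfl⟩
        exact (hT' s hs).2 ▸ s.comm_mem_gam _
      have : N.Normal := normal_of_gam_le (hN ▸ le_sup_right) hNle
      rw [Finset.coe_insert, Set.image_insert_eq, Set.insert_eq, Subgroup.closure_union, sup_assoc, ← hN,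
        ← Subgroup.zpowers_eq_closure, Subgroup.mem_sup_of_normal_right] at h
      obtain ⟨_, ⟨k, rfl⟩, z, hz, rfl⟩ := h
      obtain ⟨f, hf, χ, hχf, hχ⟩ := exists_coeff_hom hn htn.2
      have htg : t.comm FreeGroup.of ∈ gam (FreeGroup α) n := htn.2 ▸ t.comm_mem_gam _
      have hNχ : N ≤ χ.ker.map (gam (FreeGroup α) n).subtype := by
        rw [hN]
        refine sup_le ((Subgroup.closure_le _).2 ?_) ?_
        · rintro _ ⟨s, hs, rfl⟩
          refine ⟨⟨_, (hT' s hs).2 ▸ s.comm_mem_gam _⟩, ?_, rfl⟩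
          have hlt : t.word < s.word := lt_of_le_of_ne (hmin s hs) fun h =>
            htT (htn.1.eq_of_word_eq (hT' s hs).1 h ▸ hs)
          have := hχ s ⟨_, (hT' s hs).2 ▸ s.comm_mem_gam _⟩ (hT' s hs).2 rfl
          rw [(hT' s hs).1.coeff_eq_zero (by rw [htn.2, (hT' s hs).2]) hlt] at this
          exact this
        · intro g hg
          refine ⟨⟨g, gam_antitone n.le_succ hg⟩, hχf _ ?_, rfl⟩
          have := gam_le_comap_unitriangular f hf (by omega) hg
          rw [unitriangular_self] at this
          exact this
      obtain ⟨z', hz', rfl⟩ := hNχ hz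
      have h1 := hχf (⟨_, htg⟩ ^ k * z') (hcon f hf)
      have h2 := hχ t ⟨_, htg⟩ htn.2 rfl
      rw [map_mul, MonoidHom.mem_ker.1 hz', mul_one, map_zpow] at h1
      have h3 := congrArg Multiplicative.toAdd h1
      rw [toAdd_zpow, h2, htn.1.coeff_word, toAdd_one, smul_eq_zero] at h3
      have hk : k = 0 := h3.resolve_right one_ne_zero
      subst hk
      refine ih hT' ?_
      rw [← hN]
      simpa using hz
  have hfin : {t : FreeMagma α | t.IsLyndon ∧ t.word.length = n ∧ t.word ∈ Set.univ}.Finite :=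
    (FreeMagma.finite_setOf_length_word_eq n).subset fun t ht => ht.2.1
  refine key hfin.toFinset (fun t ht => ?_) ?_
  · have := hfin.mem_toFinset.1 ht
    exact ⟨this.1, this.2.1⟩
  · rw [hfin.coe_toFinset]
    rwa [gam_eq_lyndonSpan (FreeGroup.closure_range_of α) hn] at hu

end Magnus

/-! ### Finite index in nilpotent groups -/

section FiniteIndex

variable {G : Type*} [Group G]

/-- Adjoining finitely many central elements, each with a positive power in `H`, enlarges `H` only by
a finite index: the quotient is a finitely generated torsion abelian group. -/
theorem finiteIndex_of_sup_closure {H : Subgroup G} {S : Set G} (hS : S.Finite)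
    (hc : S ⊆ Subgroup.center G) (hp : ∀ s ∈ S, ∃ m, 0 < m ∧ s ^ m ∈ H)
    (hi : (H ⊔ Subgroup.closure S).FiniteIndex) : H.FiniteIndex := by
  obtain ⟨Z, hZ⟩ : ∃ Z, Z = Subgroup.closure S := ⟨_, rfl⟩
  rw [← hZ] at hi
  have hZc : Z ≤ Subgroup.center G := hZ ▸ (Subgroup.closure_le _).2 hc
  have hZn : Z.Normal := ⟨fun z hz g => by
    rwa [Subgroup.mem_center_iff.1 (hZc hz) g, mul_inv_cancel_right]⟩
  have hFG : Group.FG Z := by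
    have := hS.to_subtype
    rw [hZ]
    exact Group.closure_finite_fg S
  let _ : CommGroup Z := { (inferInstance : Group Z) with
    mul_comm := fun a b => Subtype.ext (Subgroup.mem_center_iff.1 (hZc b.2) a) }
  have hpow : ∀ z ∈ Z, ∃ m, 0 < m ∧ z ^ m ∈ H := by
    intro z hz
    rw [hZ] at hz
    induction hz using Subgroup.closure_induction with
    | mem s hs => exact hp s hs
    | one => exact ⟨1, one_pos, by simp⟩
    | mul y z hy hz ihy ihz =>
      obtain ⟨k, hk, hyk⟩ := ihy
      obtain ⟨l, hl, hzl⟩ := ihz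
      refine ⟨k * l, Nat.mul_pos hk hl, ?_⟩
      have hcomm : Commute y z := Subgroup.mem_center_iff.1 (hZc (hZ ▸ hz)) y
      rw [hcomm.mul_pow, pow_mul, mul_comm k, pow_mul]
      exact mul_mem (pow_mem hyk l) (pow_mem hzl k)
    | inv z _ ih =>
      obtain ⟨k, hk, h⟩ := ih
      exact ⟨k, hk, by rw [inv_pow]; exact inv_mem h⟩
  have hfin : Finite (Z ⧸ H.subgroupOf Z) := by
    refine CommGroup.finite_of_fg_isMulTorsion _ fun q => ?_
    obtain ⟨z, rfl⟩ := QuotientGroup.mk_surjective q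
    obtain ⟨m, hm, h⟩ := hpow z z.2
    refine isOfFinOrder_iff_pow_eq_one.2 ⟨m, hm, ?_⟩
    rw [← QuotientGroup.mk_pow, QuotientGroup.eq_one_iff]
    exact h
  have hsurj : Function.Surjective
      (Subgroup.quotientSubgroupOfEmbeddingOfLE H (le_sup_right : Z ≤ H ⊔ Z)) := by
    intro q
    obtain ⟨⟨k, hk⟩, rfl⟩ := QuotientGroup.mk_surjective q
    have hk' := hk
    rw [sup_comm, Subgroup.mem_sup_of_normal_left] at hk'
    obtain ⟨z, hz, h, hh, rfl⟩ := hk'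
    refine ⟨((⟨z, hz⟩ : Z) : Z ⧸ H.subgroupOf Z), ?_⟩
    rw [Subgroup.quotientSubgroupOfEmbeddingOfLE_apply_mk, QuotientGroup.eq]
    rw [Subgroup.mem_subgroupOf]
    simpa using hh
  have hfin' := Finite.of_surjective _ hsurj
  have h1 : (H.subgroupOf (H ⊔ Z)).FiniteIndex := Subgroup.finiteIndex_of_finite_quotient
  refine ⟨?_⟩
  rw [← Subgroup.relIndex_mul_index (le_sup_left : H ≤ H ⊔ Z)]
  exact mul_ne_zero h1.index_ne_zero hi.index_ne_zero

theorem map_gam_of_surjective {K : Type*} [Group K] {f : G →* K} (hf : Function.Surjective f)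
    (n : ℕ) : (gam G n).map f = gam K n := by
  have := Subgroup.map_lowerCentralSeries (⊤ : Subgroup G) f (n - 1)
  rwa [Subgroup.map_top_of_surjective _ hf] at this

theorem commutatorElement_pow_left_of_mem_center {x y : G} (h : ⁅x, y⁆ ∈ Subgroup.center G)
    (k : ℕ) : ⁅x ^ k, y⁆ = ⁅x, y⁆ ^ k := by
  induction k with
  | zero => simp
  | succ k ih =>
    rw [pow_succ, commutatorElement_mul_left_eq_conj_mul, ih,
      (Subgroup.mem_center_iff.1 h (x ^ k)), mul_inv_cancel_right, pow_succ']

theorem commutatorElement_pow_pow_of_mem_center {x y : G} (h : ⁅x, y⁆ ∈ Subgroup.center G)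
    (k : ℕ) : ⁅x ^ k, y ^ k⁆ = ⁅x, y⁆ ^ (k * k) := by
  have hy : ⁅x, y ^ k⁆ = ⁅x, y⁆ ^ k := by
    rw [← commutatorElement_inv, commutatorElement_pow_left_of_mem_center, ← inv_pow,
      commutatorElement_inv]
    rw [← commutatorElement_inv]
    exact inv_mem h
  rw [commutatorElement_pow_left_of_mem_center (hy ▸ pow_mem h k), hy, pow_mul]

theorem commutatorElement_mul_mul_of_mem_center {x y z z' : G} (hz : z ∈ Subgroup.center G)
    (hz' : z' ∈ Subgroup.center G) : ⁅x * z, y * z'⁆ = ⁅x, y⁆ := by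
  have h : ⁅z, y * z'⁆ = 1 :=
    (Commute.symm (Subgroup.mem_center_iff.1 hz (y * z'))).commutator_eq
  have h' : ⁅x, z'⁆ = 1 := Commute.commutator_eq (Subgroup.mem_center_iff.1 hz' x)
  rw [commutatorElement_mul_left_eq_conj_mul, h, commutatorElement_mul_right_eq_mul_conj, h']
  simp

/-- A subgroup of a finitely generated nilpotent group that contains a positive power of every
member of a finite generating family has finite index. Modulo the last term `Z` of the lower
central series this is induction; and `[x, y] ^ (d * d) = [x ^ d, y ^ d]` lies in the subgroup `H`
if `[x, y] ∈ Z` and `d` is the index of a normal subgroup contained in `H Z`. -/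
theorem finiteIndex_of_pow_mem {α : Type*} [LinearOrder α] [Finite α] {n : ℕ} (hn : 1 ≤ n)
    {x : α → G} (hx : Subgroup.closure (Set.range x) = ⊤) {H : Subgroup G} (hG : gam G n = ⊥)
    (hH : ∀ a, ∃ m, 0 < m ∧ x a ^ m ∈ H) : H.FiniteIndex := by
  induction n, hn using Nat.le_induction generalizing G with
  | base =>
    have : H = ⊤ := top_le_iff.1 (gam_one.symm.trans hG |>.le.trans bot_le)
    rw [this]
    infer_instance
  | succ n hn ih =>
    obtain ⟨S, hS⟩ : ∃ S, S = FreeMagma.comm x '' {t | t.IsLyndon ∧ t.word.length = n ∧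
      t.word ∈ Set.univ} := ⟨_, rfl⟩
    have hZS : gam G n = Subgroup.closure S := by
      rw [gam_eq_lyndonSpan hx hn, lyndonSpan, hG, sup_bot_eq, hS]
    have hZc : gam G n ≤ Subgroup.center G := by
      rw [← Subgroup.commutator_top_right_eq_bot_iff_le_center, ← gam_succ hn, hG]
    have hindex : (H ⊔ gam G n).FiniteIndex := by
      obtain ⟨π, hπ⟩ : ∃ π, π = QuotientGroup.mk' (gam G n) := ⟨_, rfl⟩
      have hsurj : Function.Surjective π := hπ ▸ QuotientGroup.mk'_surjective _
      have h := ih (G := G ⧸ gam G n) (x := π ∘ x) (H := H.map π)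
        (by rw [Set.range_comp, ← MonoidHom.map_closure, hx, Subgroup.map_top_of_surjective _ hsurj])
        (by
          rw [← map_gam_of_surjective hsurj, hπ, Subgroup.map_eq_bot_iff, QuotientGroup.ker_mk'])
        (fun a => by
          obtain ⟨m, hm, h⟩ := hH a
          exact ⟨m, hm, by rw [Function.comp_apply, ← map_pow]; exact Subgroup.mem_map_of_mem _ h⟩)
      refine ⟨?_⟩
      rw [sup_comm, ← QuotientGroup.comap_map_mk', ← hπ, Subgroup.index_comap_of_surjective _ hsurj]
      exact h.index_ne_zero
    refine finiteIndex_of_sup_closure (S := S) ?_ ?_ ?_ (hZS ▸ hindex)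
    · rw [hS]
      exact ((FreeMagma.finite_setOf_length_word_eq n).subset fun t ht => ht.2.1).image _
    · exact fun s hs => hZc (hZS ▸ Subgroup.subset_closure hs)
    · rw [hS]
      rintro _ ⟨t, ⟨-, ht, -⟩, rfl⟩
      have htc := hZc (ht ▸ t.comm_mem_gam x)
      cases t with
      | of a => exact hH a
      | mul p q =>
        rw [FreeMagma.mul_eq, FreeMagma.comm_mul] at *
        obtain ⟨d, hd⟩ : ∃ d, d = (H ⊔ gam G n).normalCore.index := ⟨_, rfl⟩
        have hd0 : 0 < d := hd ▸ Nat.pos_of_ne_zero Subgroup.FiniteIndex.index_ne_zero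
        have hmem : ∀ g : G, ∃ h ∈ H, ∃ z ∈ Subgroup.center G, h * z = g ^ d := by
          intro g
          have := Subgroup.normalCore_le _ ((H ⊔ gam G n).normalCore.pow_index_mem g)
          rw [← hd, Subgroup.mem_sup_of_normal_right] at this
          obtain ⟨h, hh, z, hz, he⟩ := this
          exact ⟨h, hh, z, hZc hz, he⟩
        obtain ⟨h, hh, z, hz, he⟩ := hmem (p.comm x)
        obtain ⟨h', hh', z', hz', he'⟩ := hmem (q.comm x)
        refine ⟨d * d, Nat.mul_pos hd0 hd0, ?_⟩
        rw [← commutatorElement_pow_pow_of_mem_center htc, ← he, ← he',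
          commutatorElement_mul_mul_of_mem_center hz hz', commutatorElement_def]
        exact mul_mem (mul_mem (mul_mem hh hh') (inv_mem hh)) (inv_mem hh')

end FiniteIndex

/-! ### Surface groups -/

section SurfaceGroup

theorem map_nonorientableRelator_succ {K : Type*} [Group K] {g : ℕ}
    (f : FreeGroup (Fin (g + 1)) →* K) :
    f (nonorientableRelator (g + 1)) =
      (List.ofFn fun i : Fin g => f (FreeGroup.of i.castSucc) ^ 2).prod *
        f (FreeGroup.of (Fin.last g)) ^ 2 := by
  rw [nonorientableRelator, map_list_prod, List.map_ofFn, List.ofFn_succ', List.concat_eq_append,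
    List.prod_append, List.prod_singleton]
  simp

/-- The homomorphism from the free group of rank `g` to the surface group of genus `g + 1` that
omits the last generator. -/
def freeToSurface (g : ℕ) : FreeGroup (Fin g) →* NonorientableSurfaceGroup (g + 1) :=
  FreeGroup.lift fun i => PresentedGroup.of i.castSucc

/-- A homomorphism from the free group of rank `g` to the unitriangular matrices extends to the
surface group of genus `g + 1`: the last generator is sent to a square root. -/
theorem exists_extension_unitriangular {g m : ℕ}
    (f : FreeGroup (Fin g) →* (Matrix (Fin m) (Fin m) ℚ)ˣ) (hf : ∀ u, f u ∈ unitriangular m 1) :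
    ∃ F : NonorientableSurfaceGroup (g + 1) →* (Matrix (Fin m) (Fin m) ℚ)ˣ,
      (∀ u, F u ∈ unitriangular m 1) ∧ F.comp (freeToSurface g) = f := by
  obtain ⟨s, hs, hsq⟩ := exists_unitriangular_sq_eq
    (inv_mem (hf (List.ofFn fun i : Fin g => FreeGroup.of i ^ 2).prod))
  have hrel : ∀ r ∈ ({nonorientableRelator (g + 1)} : Set (FreeGroup (Fin (g + 1)))),
      FreeGroup.lift (Fin.snoc (α := fun _ => (Matrix (Fin m) (Fin m) ℚ)ˣ)
        (fun i => f (FreeGroup.of i)) s) r = 1 := by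
    rintro _ rfl
    rw [map_nonorientableRelator_succ]
    simp only [FreeGroup.lift_apply_of, Fin.snoc_castSucc, Fin.snoc_last]
    rw [hsq, map_list_prod, List.map_ofFn]
    simp [Function.comp_def]
  refine ⟨PresentedGroup.toGroup hrel, ?_, ?_⟩
  · suffices h : (⊤ : Subgroup (NonorientableSurfaceGroup (g + 1))) ≤
        (unitriangular m 1).comap (PresentedGroup.toGroup hrel) from
      fun u => h (Subgroup.mem_top u)
    rw [← PresentedGroup.closure_range_of, Subgroup.closure_le]
    rintro _ ⟨i, rfl⟩
    rw [SetLike.mem_coe, Subgroup.mem_comap, PresentedGroup.toGroup.of]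
    induction i using Fin.lastCases with
    | last => simpa using hs
    | cast i => simpa using hf _
  · ext i : 1
    simp [freeToSurface, PresentedGroup.toGroup.of]

/-- An element of `γ_n` outside `γ_{n+1}` of the free group is detected by a unitriangular
representation of size `n + 1`, which kills `γ_{n+1}` of the surface group once it is extended
there. -/
theorem comap_freeToSurface_gam_le (g : ℕ) {n : ℕ} (hn : 1 ≤ n) :
    (gam (NonorientableSurfaceGroup (g + 1)) n).comap (freeToSurface g) ≤
      gam (FreeGroup (Fin g)) n := by
  induction n, hn using Nat.le_induction with
  | base => exact le_top
  | succ n hn ih =>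
    intro u hu
    by_contra hcon
    obtain ⟨f, hf, hfu⟩ := exists_unitriangular_hom_ne_one hn
      (ih (Subgroup.comap_mono (gam_antitone n.le_succ) hu)) hcon
    obtain ⟨F, hF, rfl⟩ := exists_extension_unitriangular f hf
    have := gam_le_comap_unitriangular F hF (by omega) hu
    rw [unitriangular_self] at this
    exact hfu this

/-- The homomorphism of class `c` quotients induced by `freeToSurface`. -/
def freeNilpotentToSurface (g c : ℕ) :
    FreeNilpotentGroup g c →* NilpotentQuotient (NonorientableSurfaceGroup (g + 1)) c :=
  QuotientGroup.map _ _ (freeToSurface g) <| by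
    rw [← Subgroup.map_le_iff_le_comap, Subgroup.map_lowerCentralSeries]
    exact Subgroup.lowerCentralSeries_mono c le_top

theorem freeNilpotentToSurface_gen (g c : ℕ) (i : Fin g) :
    freeNilpotentToSurface g c (FreeNilpotentGroup.gen g c i) = surfaceGen g c i := by
  simp [freeNilpotentToSurface, FreeNilpotentGroup.gen, surfaceGen, freeToSurface]

theorem freeNilpotentToSurface_injective (g c : ℕ) :
    Function.Injective (freeNilpotentToSurface g c) := by
  rw [injective_iff_map_eq_one]
  intro q hq
  obtain ⟨u, rfl⟩ := QuotientGroup.mk_surjective q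
  rw [freeNilpotentToSurface, QuotientGroup.map_mk, QuotientGroup.eq_one_iff] at hq
  rw [QuotientGroup.eq_one_iff]
  exact comap_freeToSurface_gam_le g (n := c + 1) (by omega) hq

theorem range_freeNilpotentToSurface (g c : ℕ) :
    (freeNilpotentToSurface g c).range = Subgroup.closure (Set.range (surfaceGen g c)) := by
  have h : Set.range (surfaceGen g c) =
      freeNilpotentToSurface g c '' Set.range (FreeNilpotentGroup.gen g c) := by
    rw [← Set.range_comp]
    exact congrArg _ (funext fun i => (freeNilpotentToSurface_gen g c i).symm)
  have htop : Subgroup.closure (Set.range (FreeNilpotentGroup.gen g c)) = ⊤ := by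
    have : Set.range (FreeNilpotentGroup.gen g c) =
        NilpotentQuotient.proj (FreeGroup (Fin g)) c '' Set.range FreeGroup.of := by
      rw [← Set.range_comp]
      rfl
    rw [this, ← MonoidHom.map_closure, FreeGroup.closure_range_of,
      Subgroup.map_top_of_surjective _ (QuotientGroup.mk'_surjective _)]
  rw [h, ← MonoidHom.map_closure, htop, MonoidHom.range_eq_map]

/-- The subgroup contains the first `g` generators and, by the surface relation, the square of the
last one. -/
theorem finiteIndex_closure_surfaceGen (g c : ℕ) :
    (Subgroup.closure (Set.range (surfaceGen g c))).FiniteIndex := by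
  obtain ⟨π, hπ⟩ : ∃ π, π = NilpotentQuotient.proj (NonorientableSurfaceGroup (g + 1)) c :=
    ⟨_, rfl⟩
  have hsurj : Function.Surjective π := hπ ▸ QuotientGroup.mk'_surjective _
  have hcast : ∀ i : Fin g, π (PresentedGroup.of i.castSucc) ∈
      Subgroup.closure (Set.range (surfaceGen g c)) :=
    fun i => Subgroup.subset_closure ⟨i, by rw [hπ]; rfl⟩
  refine finiteIndex_of_pow_mem (n := c + 1) (by omega) (x := fun i => π (PresentedGroup.of i))
    ?_ ?_ ?_
  · have : Set.range (fun i => π (PresentedGroup.of i)) = π '' Set.range PresentedGroup.of :=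
      Set.range_comp _ _
    rw [this, ← MonoidHom.map_closure, PresentedGroup.closure_range_of,
      Subgroup.map_top_of_surjective _ hsurj]
  · rw [← map_gam_of_surjective hsurj, hπ, Subgroup.map_eq_bot_iff, QuotientGroup.ker_mk']
    exact le_rfl
  · intro i
    induction i using Fin.lastCases with
    | cast i => exact ⟨1, one_pos, by simpa using hcast i⟩
    | last =>
      refine ⟨2, two_pos, ?_⟩
      have hrel : PresentedGroup.mk {nonorientableRelator (g + 1)} (nonorientableRelator (g + 1)) =
          1 := PresentedGroup.one_of_mem rfl
      have h := map_nonorientableRelator_succ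
        (π.comp (PresentedGroup.mk {nonorientableRelator (g + 1)}))
      rw [MonoidHom.comp_apply, hrel, map_one] at h
      have h' := eq_inv_of_mul_eq_one_right h.symm
      refine (congrArg (· ∈ Subgroup.closure (Set.range (surfaceGen g c))) h').mpr (inv_mem ?_)
      refine list_prod_mem fun y hy => ?_
      obtain ⟨i, rfl⟩ := List.mem_ofFn.1 hy
      exact pow_mem (hcast i) 2

end SurfaceGroup

theorem mainTheorem4 (g c : ℕ) (hc : 1 ≤ c) :
    (∃ φ : FreeNilpotentGroup g c ≃* Subgroup.closure (Set.range (surfaceGen g c)),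
      ∀ i : Fin g,
        (φ (FreeNilpotentGroup.gen g c i) :
          NilpotentQuotient (NonorientableSurfaceGroup (g + 1)) c) = surfaceGen g c i) ∧
    (Subgroup.closure (Set.range (surfaceGen g c))).FiniteIndex := by
  refine ⟨⟨(MonoidHom.ofInjective (freeNilpotentToSurface_injective g c)).trans
    (MulEquiv.subgroupCongr (range_freeNilpotentToSurface g c)), fun i => ?_⟩,
    finiteIndex_closure_surfaceGen g c⟩
  exact freeNilpotentToSurface_gen g c i
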